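/- Let $M$ be a (finite-dimensional, Hausdorff) complex manifold, let $\|\cdot\|$ be a Hermitian metric on $TM$, and let $d_M$ be the corresponding integrated distance, i.e. the infimum of the lengths of $C^1$ paths (equal to $+\infty$ for points in different connected components). Let $d\in[1,+\infty]$. A family $(\varphi_{s,t})_{0\le s\le t}$ of holomorphic maps $\varphi_{s,t}\colon M\to M$ is called an $L^d$-evolution family (evolution family of order $d$) if 1. $\varphi_{s,s}=\mathrm{id}$ for all $s\ge 0$, and $\varphi_{s,t}=\varphi_{u,t}\circ\varphi_{s,u}$ for all $0\le s\le u\le t$; 2. for every $T>0$ and every compact set $K\subset M$ there is a function $c_{T,K}\in L^d([0,T],\mathbb{R}^+)$ such that $$d_M(\varphi_{s,t}(z),\varphi_{s,u}(z))\le\int_u^t c_{T,K}(\xi)\,d\xi\qquad\text{for all } z\in K,\ 0\le s\le u\le t\le T.$$ If $(\varphi_{s,t})$ is an $L^d$-evolution family on $M$ for some $d\in[1,+\infty]$, then for all $0\le s\le t$ the map $\varphi_{s,t}\colon M\to M$ is univalent, i.e. holomorphic and injective. -/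

import Mathlib

open Set MeasureTheory
open scoped Manifold ContDiff ENNReal Bundle

noncomputable section

/-- The smooth real manifold underlying a complex manifold. -/
instance IsManifold.complexToReal
    {E : Type*} [NormedAddCommGroup E] [NormedSpace ℂ E]
    {M : Type*} [TopologicalSpace M] [ChartedSpace E M] [IsManifold 𝓘(ℂ, E) ω M] :
    IsManifold 𝓘(ℝ, E) ∞ M := by
  refine isManifold_of_contDiffOn _ _ _ fun e e' he he' => ?_
  have h := (contDiffGroupoid ω 𝓘(ℂ, E)).compatible he he'
  rw [contDiffGroupoid, mem_groupoid_of_pregroupoid] at h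
  have h1 : ContDiffOn ℂ ω (𝓘(ℂ, E) ∘ (e.symm.trans e') ∘ 𝓘(ℂ, E).symm)
      (𝓘(ℂ, E).symm ⁻¹' (e.symm.trans e').source ∩ range 𝓘(ℂ, E)) := h.1
  exact (h1.restrict_scalars ℝ).of_le le_top

/-- A (smooth) Hermitian metric on the complex manifold `M`, given through its real part: a smooth
Riemannian metric `g` on the underlying real manifold with `g (i v) (i w) = g v w`. The Hermitian
form itself is `(v, w) ↦ g v w + i g v (i w)` (linear in `v`, antilinear in `w`), and both induce
the same norm `‖v‖ = √(g v v)` on tangent vectors. -/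
structure HermitianMetric
    (E : Type*) [NormedAddCommGroup E] [NormedSpace ℂ E]
    (M : Type*) [TopologicalSpace M] [ChartedSpace E M] [IsManifold 𝓘(ℂ, E) ω M]
    extends Bundle.ContMDiffRiemannianMetric 𝓘(ℝ, E) ∞ E
      (fun x : M => TangentSpace 𝓘(ℝ, E) x) where
  /-- Compatibility with the complex structure. -/
  inner_I_smul (x : M) (v w : E) :
    inner x (Complex.I • v : E) (Complex.I • w : E) = inner x v w

section

variable {E : Type*} [NormedAddCommGroup E] [NormedSpace ℂ E]
  {M : Type*} [TopologicalSpace M] [ChartedSpace E M] [IsManifold 𝓘(ℂ, E) ω M]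

/-- The integrated distance of a Hermitian metric: the infimum of the lengths of the `C¹` paths
from `x` to `y`, which is `∞` when `x` and `y` lie in different connected components. -/
def HermitianMetric.distance (h : HermitianMetric E M) (x y : M) : ℝ≥0∞ :=
  letI : Bundle.RiemannianBundle (fun x : M => TangentSpace 𝓘(ℝ, E) x) :=
    ⟨h.toContMDiffRiemannianMetric.toRiemannianMetric⟩
  Manifold.riemannianEDist 𝓘(ℝ, E) x y

variable (E) in
/-- A holomorphic self-map. -/
def IsHolomorphicSelfMap (f : M → M) : Prop :=
  MDifferentiable 𝓘(ℂ, E) 𝓘(ℂ, E) f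

variable (E) in
/-- A univalent self-map, that is, a holomorphic and injective one. -/
def IsUnivalentSelfMap (f : M → M) : Prop :=
  IsHolomorphicSelfMap E f ∧ Function.Injective f

/-- `φ` is an evolution family of order `d` on `M`, where distances are taken with respect to the
Hermitian metric `h`. Only the maps `φ s t` with `0 ≤ s ≤ t` matter. -/
structure IsEvolutionFamily (h : HermitianMetric E M) (d : ℝ≥0∞) (φ : ℝ → ℝ → M → M) :
    Prop where
  holomorphic : ∀ s t : ℝ, 0 ≤ s → s ≤ t → IsHolomorphicSelfMap E (φ s t)
  self_eq_id : ∀ s : ℝ, 0 ≤ s → φ s s = id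
  evolution : ∀ s u t : ℝ, 0 ≤ s → s ≤ u → u ≤ t → φ s t = φ u t ∘ φ s u
  regularity : ∀ T : ℝ, 0 < T → ∀ K : Set M, IsCompact K →
    ∃ c : ℝ → ℝ, (∀ ξ ∈ Icc 0 T, 0 ≤ c ξ) ∧ MemLp c d (volume.restrict (Icc 0 T)) ∧
      ∀ z ∈ K, ∀ s u t : ℝ, 0 ≤ s → s ≤ u → u ≤ t → t ≤ T →
        h.distance (φ s t z) (φ s u z) ≤ ENNReal.ofReal (∫ ξ in u..t, c ξ)

end

end

/-! If two trajectories from distinct points meet, continuity and the Hausdorff property give a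
first meeting time `τ > s`. For `r < τ` close to `τ`, the map `φ r τ` is close to the identity on a
compact neighbourhood of the meeting point. By the Schwarz lemma applied to `f - id` in a chart, it
is then injective on a neighbourhood `U` that does not depend on `r`
(`HermitianMetric.exists_injOn_of_distance_lt`). Both trajectories lie in `U` just before `τ`, so
they already agree at such an `r`, a contradiction. -/

open Metric in
/-- A holomorphic map of a ball that is close to the identity is injective on a smaller ball. -/
theorem injOn_ball_of_dist_self_le
    {E : Type*} [NormedAddCommGroup E] [NormedSpace ℂ E] {f : E → E} {p : E} {R δ : ℝ}
    (hf : DifferentiableOn ℂ f (ball p R)) (hδ : 4 * δ < R)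
    (hfδ : ∀ x ∈ ball p R, dist (f x) x ≤ δ) : InjOn f (ball p (R / 4)) := by
  intro z hz w hw hzw
  have hR : 0 < R := by have := pos_of_mem_ball hz; linarith
  rw [mem_ball] at hz hw
  have hsub : ball z (R / 2) ⊆ ball p R := ball_subset_ball' (by linarith)
  have hmaps : MapsTo (fun x => f x - x) (ball z (R / 2)) (closedBall (f z - z) (2 * δ)) := by
    intro x hx
    rw [mem_closedBall, dist_eq_norm]
    have h1 := hfδ x (hsub hx)
    have h2 := hfδ z (hsub (mem_ball_self (by linarith)))
    rw [dist_eq_norm] at h1 h2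
    linarith [norm_sub_le (f x - x) (f z - z)]
  have hwz : w ∈ ball z (R / 2) := by
    rw [mem_ball]
    linarith [dist_triangle_right w z p]
  -- Schwarz lemma: `f - id` is Lipschitz at `z` with constant `4δ/R < 1`, whereas `f z = f w`
  -- forces its values at `z` and `w` to differ by exactly `dist w z`.
  have key := Complex.dist_le_div_mul_dist_of_mapsTo_ball
    ((hf.mono hsub).sub differentiableOn_id) hmaps hwz
  have heq : dist (f w - w) (f z - z) = dist w z := by
    rw [hzw, dist_sub_left]
  simp only [id, Pi.sub_apply] at key
  rw [heq] at key
  have hc : 2 * δ / (R / 2) < 1 := by rw [div_lt_one (by linarith)]; linarith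
  have hwz0 : dist w z = 0 := by
    by_contra hne
    have hpos : 0 < dist w z := lt_of_le_of_ne dist_nonneg (Ne.symm hne)
    nlinarith
  exact (dist_eq_zero.1 hwz0).symm

open Topology in
/-- Points close to a compact set on which a map is continuous have values close to those on it,
uniformly. -/
theorem IsCompact.exists_edist_lt_imp_dist_lt {X Y : Type*} [PseudoEMetricSpace X]
    [PseudoMetricSpace Y] {K U : Set X} (hK : IsCompact K) (hU : IsOpen U) (hKU : K ⊆ U)
    {f : X → Y} (hf : ContinuousOn f U) {δ : ℝ} (hδ : 0 < δ) :
    ∃ ε > 0, ∀ x ∈ K, ∀ y, edist y x < ε → y ∈ U ∧ dist (f y) (f x) < δ := by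
  -- The Lebesgue number puts `x` and `y` in one member of the cover; its centre `q` costs `δ / 2`
  -- for each.
  obtain ⟨ε, hε, h⟩ := lebesgue_number_lemma_of_emetric_nhds
    (c := fun x => U ∩ {y | dist (f y) (f x) < δ / 2}) hK (fun x hx => by
      have hxU := hU.mem_nhds (hKU hx)
      exact Filter.inter_mem hxU
        ((hf.continuousAt hxU).eventually (Metric.ball_mem_nhds (f x) (half_pos hδ))))
  refine ⟨ε, hε, fun x hx y hy => ?_⟩
  obtain ⟨q, hq⟩ := h x hx
  have h1 := hq (show y ∈ Metric.eball x ε from hy)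
  have h2 := hq (Metric.mem_eball_self hε)
  refine ⟨h1.1, ?_⟩
  have h3 : dist (f y) (f q) < δ / 2 := h1.2
  have h4 : dist (f x) (f q) < δ / 2 := h2.2
  linarith [dist_triangle_right (f y) (f x) (f q)]

/-- The integral over short intervals is uniformly small. -/
theorem exists_forall_intervalIntegral_lt {c : ℝ → ℝ} {T : ℝ} (hc : IntegrableOn c (Icc 0 T))
    {η : ℝ} (hη : 0 < η) :
    ∃ δ > 0, ∀ u t : ℝ, 0 ≤ u → u ≤ t → t ≤ T → t - u < δ → ∫ ξ in u..t, c ξ < η := by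
  have hcont : ContinuousOn (fun x => ∫ ξ in (0 : ℝ)..x, c ξ) (Icc 0 T) :=
    by
    refine (intervalIntegral.continuousOn_primitive_Icc hc).congr fun x hx => ?_
    simp only [intervalIntegral.integral_of_le hx.1, integral_Icc_eq_integral_Ioc]
  obtain ⟨δ, hδ, h⟩ := Metric.uniformContinuousOn_iff.1
    (isCompact_Icc.uniformContinuousOn_of_continuous hcont) η hη
  refine ⟨δ, hδ, fun u t hu hut htT htu => ?_⟩
  have hint : ∀ x ∈ Icc 0 T, IntervalIntegrable c volume 0 x := fun x hx =>
    (intervalIntegrable_iff_integrableOn_Icc_of_le hx.1).2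
      (hc.mono_set (Icc_subset_Icc_right hx.2))
  have htm : t ∈ Icc 0 T := ⟨hu.trans hut, htT⟩
  have hum : u ∈ Icc 0 T := ⟨hu, hut.trans htT⟩
  have h1 := h t htm u hum (by rwa [Real.dist_eq, abs_of_nonneg (by linarith)])
  rw [Real.dist_eq, intervalIntegral.integral_interval_sub_left (hint t htm) (hint u hum)] at h1
  exact (le_abs_self _).trans_lt h1

section

variable {E : Type*} [NormedAddCommGroup E] [NormedSpace ℂ E]
  {M : Type*} [TopologicalSpace M] [ChartedSpace E M] [IsManifold 𝓘(ℂ, E) ω M]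

/-- The integrated distance of a Hermitian metric, as an extended pseudometric that induces the
topology of the manifold. -/
@[reducible] noncomputable def HermitianMetric.pseudoEMetricSpace [RegularSpace M]
    (h : HermitianMetric E M) : PseudoEMetricSpace M :=
  letI : Bundle.RiemannianBundle (fun x : M => TangentSpace 𝓘(ℝ, E) x) :=
    ⟨h.toContMDiffRiemannianMetric.toRiemannianMetric⟩
  haveI : IsContinuousRiemannianBundle E (fun x : M => TangentSpace 𝓘(ℝ, E) x) :=
    ⟨⟨h.inner, h.contMDiff.continuous, fun _ _ _ => rfl⟩⟩
  PseudoEMetricSpace.ofRiemannianMetric 𝓘(ℝ, E) M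

open Metric Topology in
/-- Holomorphic self-maps that are close enough to the identity on a compact neighbourhood of a
point are injective near that point, uniformly. -/
theorem HermitianMetric.exists_injOn_of_distance_lt [FiniteDimensional ℂ E] [RegularSpace M]
    (h : HermitianMetric E M) (p : M) :
    ∃ K : Set M, IsCompact K ∧ ∃ U ∈ 𝓝 p, ∃ ε > 0, ∀ f : M → M, IsHolomorphicSelfMap E f →
      (∀ x ∈ K, h.distance (f x) x < ε) → InjOn f U := by
  let := h.pseudoEMetricSpace
  have : ProperSpace E := FiniteDimensional.proper ℂ E
  set e := chartAt E p with he
  have hp : p ∈ e.source := mem_chart_source E p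
  obtain ⟨R, hR, hball⟩ := Metric.nhds_basis_closedBall.mem_iff.1
    (e.open_target.mem_nhds (e.map_source hp))
  have hKs : e.symm '' closedBall (e p) R ⊆ e.source :=
    image_subset_iff.2 fun x hx => e.map_target (hball hx)
  have hK : IsCompact (e.symm '' closedBall (e p) R) :=
    (isCompact_closedBall _ _).image_of_continuousOn (e.continuousOn_symm.mono hball)
  -- Any bound below `R / 4` would do, as the Schwarz argument needs `4 * δ < R`.
  obtain ⟨ε, hε, hclose⟩ := hK.exists_edist_lt_imp_dist_lt e.open_source hKs e.continuousOn
    (δ := R / 5) (by linarith)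
  refine ⟨_, hK, e.source ∩ e ⁻¹' ball (e p) (R / 4), ?_, ε, hε, fun f hf hfK => ?_⟩
  · exact (e.isOpen_inter_preimage isOpen_ball).mem_nhds ⟨hp, mem_ball_self (by linarith)⟩
  have hfx : ∀ x ∈ closedBall (e p) R,
      f (e.symm x) ∈ e.source ∧ dist (e (f (e.symm x))) x < R / 5 := by
    intro x hx
    have h1 := hclose (e.symm x) (mem_image_of_mem _ hx) (f (e.symm x))
      (hfK _ (mem_image_of_mem _ hx))
    rwa [e.right_inv (hball hx)] at h1
  have hdiff : DifferentiableOn ℂ (e ∘ f ∘ e.symm) (ball (e p) R) := by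
    rw [← mdifferentiableOn_iff_differentiableOn]
    have hM := mdifferentiable_chart (I := 𝓘(ℂ, E)) (M := M) p
    have h1 : MDifferentiableOn 𝓘(ℂ, E) 𝓘(ℂ, E) e.symm (ball (e p) R) :=
      hM.2.mono (ball_subset_closedBall.trans hball)
    have hf' : MDifferentiable 𝓘(ℂ, E) 𝓘(ℂ, E) f := hf
    exact MDifferentiableOn.comp hM.1 (hf'.comp_mdifferentiableOn h1)
      (fun x hx => (hfx x (ball_subset_closedBall hx)).1)
  have hinj := injOn_ball_of_dist_self_le hdiff (δ := R / 5) (by linarith)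
    (fun x hx => (hfx x (ball_subset_closedBall hx)).2.le)
  intro z hz w hw hzw
  refine e.injOn hz.1 hw.1 (hinj hz.2 hw.2 ?_)
  simp only [Function.comp_apply]
  rw [e.left_inv hz.1, e.left_inv hw.1, hzw]

namespace IsEvolutionFamily

variable {h : HermitianMetric E M} {d : ℝ≥0∞} {φ : ℝ → ℝ → M → M}

/-- An evolution family is equicontinuous in its second time, uniformly on compact sets and in the
first time. -/
theorem exists_distance_lt (hφ : IsEvolutionFamily h d φ) (hd : 1 ≤ d) {T : ℝ} (hT : 0 < T)
    {K : Set M} (hK : IsCompact K) {ε : ℝ≥0∞} (hε : 0 < ε) :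
    ∃ δ > 0, ∀ z ∈ K, ∀ s u t : ℝ, 0 ≤ s → s ≤ u → u ≤ t → t ≤ T → t - u < δ →
      h.distance (φ s t z) (φ s u z) < ε := by
  obtain ⟨c, -, hcd, hc⟩ := hφ.regularity T hT K hK
  obtain ⟨η, hη, hηε⟩ := ENNReal.lt_iff_exists_nnreal_btwn.1 hε
  have hη0 : (0 : ℝ) < η := by exact_mod_cast hη
  -- On the bounded interval `[0, T]`, `L^d` is contained in `L^1` because `1 ≤ d`.
  obtain ⟨δ, hδ, hδc⟩ := exists_forall_intervalIntegral_lt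
    (MemLp.integrable hd hcd) hη0
  refine ⟨δ, hδ, fun z hz s u t hs hsu hut htT htu => ?_⟩
  refine (hc z hz s u t hs hsu hut htT).trans_lt (lt_of_le_of_lt ?_ hηε)
  rw [← ENNReal.ofReal_coe_nnreal]
  exact ENNReal.ofReal_le_ofReal (hδc u t (hs.trans hsu) hut htT htu).le

/-- The trajectories of an evolution family are continuous. -/
theorem continuousOn_Icc [RegularSpace M] (hφ : IsEvolutionFamily h d φ) (hd : 1 ≤ d) {s t : ℝ}
    (hs : 0 ≤ s) (z : M) : ContinuousOn (fun τ => φ s τ z) (Icc s t) := by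
  let := h.pseudoEMetricSpace
  intro u hu
  -- The horizon is `t + 1` because `t` itself may be `0`.
  have hT : 0 < t + 1 := by linarith [hu.1, hu.2]
  refine EMetric.tendsto_nhds.2 fun ε hε => ?_
  obtain ⟨δ, hδ, hδε⟩ := hφ.exists_distance_lt hd hT (isCompact_singleton (x := z)) hε
  filter_upwards [self_mem_nhdsWithin,
    mem_nhdsWithin_of_mem_nhds (Metric.ball_mem_nhds u hδ)] with v hv hvu
  rw [Metric.mem_ball, Real.dist_eq, abs_lt] at hvu
  rcases le_total u v with huv | huv
  · exact hδε z rfl s u v hs hu.1 huv (by linarith [hv.2]) (by linarith)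
  · rw [edist_comm]
    exact hδε z rfl s v u hs hv.1 huv (by linarith [hu.2]) (by linarith)

/-- The maps of an evolution family are injective. -/
theorem injective [FiniteDimensional ℂ E] [T2Space M] [RegularSpace M]
    (hφ : IsEvolutionFamily h d φ) (hd : 1 ≤ d) {s t : ℝ} (hs : 0 ≤ s) (hst : s ≤ t) :
    Function.Injective (φ s t) := by
  intro z w hzw
  by_contra hne
  have hz := hφ.continuousOn_Icc hd (t := t) hs z
  have hw := hφ.continuousOn_Icc hd (t := t) hs w
  set S : Set ℝ := Icc s t ∩ (fun τ => (φ s τ z, φ s τ w)) ⁻¹' diagonal M with hS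
  have hSc : IsClosed S :=
    (hz.prodMk hw).preimage_isClosed_of_isClosed isClosed_Icc isClosed_diagonal
  have hSb : BddBelow S := ⟨s, fun τ hτ => hτ.1.1⟩
  have hτS : sInf S ∈ S := hSc.csInf_mem ⟨t, right_mem_Icc.2 hst, hzw⟩ hSb
  set τ := sInf S
  have hτeq : φ s τ z = φ s τ w := hτS.2
  have hsτ : s < τ := by
    refine lt_of_le_of_ne hτS.1.1 fun hsτ => hne ?_
    rw [← hsτ, hφ.self_eq_id s hs] at hτeq
    exact hτeq
  obtain ⟨K, hK, U, hU, ε, hε, hinj⟩ := h.exists_injOn_of_distance_lt (φ s τ z)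
  obtain ⟨δ, hδ, hδε⟩ := hφ.exists_distance_lt hd (hs.trans_lt hsτ) hK hε
  have hle : nhdsWithin τ (Ico s τ) ≤ nhdsWithin τ (Icc s t) :=
    nhdsWithin_mono _ fun x hx => ⟨hx.1, hx.2.le.trans hτS.1.2⟩
  have hzU := (hz τ hτS.1).mono_left hle hU
  have hwU := (hw τ hτS.1).mono_left hle (by rwa [← hτeq] : U ∈ nhds (φ s τ w))
  have : (nhdsWithin τ (Ico s τ)).NeBot := by
    rw [nhdsWithin_Ico_eq_nhdsLT hsτ]; infer_instance
  obtain ⟨r, ⟨⟨⟨hrz, hrw⟩, hrI⟩, hrδ⟩⟩ := Filter.NeBot.nonempty_of_mem this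
    (Filter.inter_mem (Filter.inter_mem (Filter.inter_mem hzU hwU) self_mem_nhdsWithin)
      (mem_nhdsWithin_of_mem_nhds (Metric.ball_mem_nhds τ hδ)))
  rw [Metric.mem_ball, Real.dist_eq, abs_lt] at hrδ
  have hr0 : 0 ≤ r := hs.trans hrI.1
  have hev := hφ.evolution s r τ hs hrI.1 hrI.2.le
  have hrinj : InjOn (φ r τ) U := by
    refine hinj _ (hφ.holomorphic r τ hr0 hrI.2.le) fun x hx => ?_
    -- Starting time and earlier time are both `r`: as `φ r r = id`, this compares `φ r τ` with the
    -- identity.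
    have := hδε x hx r r τ hr0 le_rfl hrI.2.le le_rfl (by linarith)
    rwa [hφ.self_eq_id r hr0] at this
  have hreq : φ s r z = φ s r w := by
    refine hrinj hrz hrw ?_
    rw [hev] at hτeq
    exact hτeq
  exact hrI.2.not_ge (csInf_le hSb ⟨⟨hrI.1, hrI.2.le.trans hτS.1.2⟩, hreq⟩)

end IsEvolutionFamily

end

theorem proposition6p7
    {E : Type*} [NormedAddCommGroup E] [NormedSpace ℂ E] [FiniteDimensional ℂ E]
    {M : Type*} [TopologicalSpace M] [T2Space M] [ChartedSpace E M] [IsManifold 𝓘(ℂ, E) ω M]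
    (h : HermitianMetric E M) (d : ℝ≥0∞) (hd : 1 ≤ d)
    (φ : ℝ → ℝ → M → M) (hφ : IsEvolutionFamily h d φ)
    (s t : ℝ) (hs : 0 ≤ s) (hst : s ≤ t) :
    IsUnivalentSelfMap E (φ s t) := by

  -- Local compactness and the Hausdorff property make `M` regular, as `hφ.injective` requires.
  have : LocallyCompactSpace M := by
    have : ProperSpace E := FiniteDimensional.proper ℂ E
    exact ChartedSpace.locallyCompactSpace E M
  exact ⟨hφ.holomorphic s t hs hst, hφ.injective hd hs hst⟩
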